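/- Let $\Lambda=\{m(1,0)+n(\tfrac12,\tfrac{\sqrt3}{2}):m,n\in\mathbb Z\}\subset\mathbb R^2$ and let $G$ be the triangular lattice graph: its vertex set is $\Lambda$, its edges join the points of $\Lambda$ at distance $1$, and all edge weights are $1$. For a finite $\Omega\subset\Lambda$ let $\sharp\Omega$ be its cardinality and let $$\overrightarrow{\partial\Omega}=\{(x,y):\ \{x,y\}\text{ is an edge of }G,\ x\in\Omega,\ y\notin\Omega\}$$ be its oriented edge boundary. Consider the inequality $$\frac{(\sharp\overrightarrow{\partial\Omega}-6)^2}{4\,\sharp\Omega-\sharp\overrightarrow{\partial\Omega}+2}\ \ge\ 12.\qquad(*)$$ 1. $(*)$ holds for every finite $\Omega\subset\Lambda$ for which the denominator $4\,\sharp\Omega-\sharp\overrightarrow{\partial\Omega}+2$ is positive. 2. Suppose that the finite set $\Omega$ is a union of triangles (every point of $\Omega$ is a vertex of a unit lattice triangle whose three vertices all lie in $\Omega$) and that the points of $\Omega$ with fewer than six neighbours in $\Omega$ are exactly the vertices of a single cycle of $G$ without repeated vertices. Then the denominator is positive and $(*)$ holds. 3. For $k\ge 0$ let $H_k=\{m(1,0)+n(\tfrac12,\tfrac{\sqrt3}{2}):\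 m,n\in\mathbb Z,\ |m|\le k,\ |n|\le k,\ |m+n|\le k\}$ be the regular hexagon with $k$ graph edges on each side. Then $\sharp H_k=3k^2+3k+1$ and $\sharp\overrightarrow{\partial H_k}=12k+6$. For every $k\ge1$ the set $H_k$ satisfies the hypotheses of part 2, and equality holds in $(*)$ for $\Omega=H_k$. -/

import Mathlib

namespace TriangularGraph

/-- The point `m • (1, 0) + n • (1/2, √3/2)` of the Euclidean plane. The triangular lattice `Λ` is
the range of this (injective) map, so its points are indexed by the pairs `(m, n) : ℤ × ℤ`. -/
noncomputable def pos (x : ℤ × ℤ) : EuclideanSpace ℝ (Fin 2) :=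
  !₂[(x.1 : ℝ) + (x.2 : ℝ) / 2, (x.2 : ℝ) * (√3 / 2)]

theorem dist_pos_sq (x y : ℤ × ℤ) :
    dist (pos x) (pos y) ^ 2 =
      (((x.1 - y.1) ^ 2 + (x.1 - y.1) * (x.2 - y.2) + (x.2 - y.2) ^ 2 : ℤ) : ℝ) := by
  have h3 : (√3 : ℝ) ^ 2 = 3 := Real.sq_sqrt (by norm_num)
  rw [EuclideanSpace.dist_eq, Real.sq_sqrt (by positivity)]
  simp only [pos, Fin.sum_univ_two, Real.dist_eq, sq_abs]
  simp
  linear_combination ((x.2 : ℝ) - y.2) ^ 2 / 4 * h3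

theorem pos_injective : Function.Injective pos := by
  intro x y h
  have h0 := dist_pos_sq x y
  rw [h, dist_self] at h0
  have h1 : (x.1 - y.1) ^ 2 + (x.1 - y.1) * (x.2 - y.2) + (x.2 - y.2) ^ 2 = 0 := by
    have h2 : (((x.1 - y.1) ^ 2 + (x.1 - y.1) * (x.2 - y.2) + (x.2 - y.2) ^ 2 : ℤ) : ℝ) = 0 := by
      rw [← h0]; norm_num
    exact_mod_cast h2
  have ha : x.1 - y.1 = 0 := by
    have : (x.1 - y.1) ^ 2 = 0 := by
      nlinarith [sq_nonneg ((x.1 - y.1) + 2 * (x.2 - y.2)), sq_nonneg (x.1 - y.1)]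
    exact pow_eq_zero_iff (two_ne_zero) |>.1 this
  have hb : x.2 - y.2 = 0 := by
    rw [ha] at h1
    simpa using h1
  exact Prod.ext (by omega) (by omega)

/-- The triangular lattice graph: the vertices are the points of `Λ`, and the edges join nearest
neighbours, i.e. points of `Λ` at Euclidean distance `1`. -/
def graph : SimpleGraph (ℤ × ℤ) where
  Adj x y := dist (pos x) (pos y) = 1
  symm := ⟨fun x y h => by rw [dist_comm]; exact h⟩
  loopless := ⟨fun x h => by simp at h⟩

theorem graph_adj_iff (x y : ℤ × ℤ) :
    graph.Adj x y ↔
      (x.1 - y.1) ^ 2 + (x.1 - y.1) * (x.2 - y.2) + (x.2 - y.2) ^ 2 = 1 := by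
  change dist (pos x) (pos y) = 1 ↔ _
  have h := dist_pos_sq x y
  constructor
  · intro h1
    rw [h1] at h
    have h2 : (((x.1 - y.1) ^ 2 + (x.1 - y.1) * (x.2 - y.2) + (x.2 - y.2) ^ 2 : ℤ) : ℝ) = 1 := by
      rw [← h]; norm_num
    exact_mod_cast h2
  · intro h1
    rw [h1] at h
    have h0 : (0 : ℝ) ≤ dist (pos x) (pos y) := dist_nonneg
    push_cast at h
    nlinarith

/-- The oriented edge boundary of `Ω`: the pairs `(x, y)` with `{x, y}` an edge of the graph,
`x ∈ Ω` and `y ∉ Ω`. -/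
def orientedBoundary (Ω : Finset (ℤ × ℤ)) : Set ((ℤ × ℤ) × (ℤ × ℤ)) :=
  {p | graph.Adj p.1 p.2 ∧ p.1 ∈ Ω ∧ p.2 ∉ Ω}

/-- The oriented edge boundary of a finite set is finite, so that `Set.ncard` counts it. -/
theorem orientedBoundary_finite (Ω : Finset (ℤ × ℤ)) : (orientedBoundary Ω).Finite := by
  have hB : (Set.Icc (-1 : ℤ) 1 ×ˢ Set.Icc (-1 : ℤ) 1).Finite :=
    (Set.finite_Icc _ _).prod (Set.finite_Icc _ _)
  refine ((Ω.finite_toSet.prod hB).image (fun q => (q.1, q.1 - q.2))).subset ?_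
  rintro ⟨x, y⟩ ⟨hxy, hx, -⟩
  rw [graph_adj_iff] at hxy
  simp only at hxy
  refine ⟨(x, x - y), ⟨hx, ?_⟩, by simp⟩
  have h1 : (x.1 - y.1) ^ 2 ≤ 1 := by
    by_contra! hc
    nlinarith [sq_nonneg ((x.1 - y.1) + 2 * (x.2 - y.2))]
  have h2 : (x.2 - y.2) ^ 2 ≤ 1 := by
    by_contra! hc
    nlinarith [sq_nonneg (2 * (x.1 - y.1) + (x.2 - y.2))]
  simp only [Set.mem_prod, Set.mem_Icc, Prod.fst_sub, Prod.snd_sub]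
  refine ⟨⟨?_, ?_⟩, ?_, ?_⟩ <;> nlinarith

/-- `♯∂Ω`, the number of oriented boundary edges (all edge weights are `1`). -/
noncomputable def perimeter (Ω : Finset (ℤ × ℤ)) : ℕ := (orientedBoundary Ω).ncard

/-- `Ω` is a union of triangles: every point of `Ω` is a vertex of a unit triangle of the lattice
all of whose three vertices lie in `Ω`. -/
def IsUnionOfTriangles (Ω : Finset (ℤ × ℤ)) : Prop :=
  ∀ x ∈ Ω, ∃ y ∈ Ω, ∃ z ∈ Ω, graph.Adj x y ∧ graph.Adj y z ∧ graph.Adj z x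

/-- The boundary vertices of `Ω`: the points of `Ω` with fewer than six neighbours in `Ω`. -/
def boundaryVertices (Ω : Finset (ℤ × ℤ)) : Set (ℤ × ℤ) :=
  {x | x ∈ Ω ∧ {y | y ∈ Ω ∧ graph.Adj x y}.ncard < 6}

/-- The boundary vertices of `Ω` form a single cycle without repeated vertices: they are exactly
the vertices visited by one simple closed cycle of the graph. -/
def BoundaryIsSimpleCycle (Ω : Finset (ℤ × ℤ)) : Prop :=
  ∃ (v : ℤ × ℤ) (w : graph.Walk v v), w.IsCycle ∧ {x | x ∈ w.support} = boundaryVertices Ω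

/-- The regular hexagon `H_k` centred at the origin, with `k` graph edges on each side. Its corners
are `(±k, 0)`, `(0, ±k)`, `±(k, -k)` in lattice coordinates, and its sides lie on the lattice lines
`m = ±k`, `n = ±k`, `m + n = ±k`. -/
noncomputable def hexagon (k : ℕ) : Finset (ℤ × ℤ) :=
  (Finset.Icc (-(k : ℤ)) k ×ˢ Finset.Icc (-(k : ℤ)) k).filter fun x =>
    -(k : ℤ) ≤ x.1 + x.2 ∧ x.1 + x.2 ≤ k

end TriangularGraph

/-! Write N for the cardinality and P for the perimeter. Clearing the positive denominator cancels
the terms linear in P, so (*) is equivalent to the edge-isoperimetric inequality 48 N ≤ P² + 12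
(`card_le_perimeter_sq`).

Let a, b, c count the lattice lines of the three directions that meet Ω. Each line leaves Ω at both
ends, so P ≥ 2(a + b + c). A point (m, n) lies on the lines labelled m, n and m + n, so N is at most
the number of pairs in A × B with sum in C. A discrete Riesz rearrangement bounds this by ((a + b +
c)² + 3) / 12.

In a union of triangles each point misses at most four neighbours, so P ≤ 4 N and the denominator is
at least 2. For hexagons every line leaves only once each way, which gives equality. -/

namespace TriangularGraph

/-! ### Counting pairs with prescribed sums -/

/-- The pairs in `A × B` whose sum lies in `C`. -/
def sumPairs (A B C : Finset ℤ) : Finset (ℤ × ℤ) :=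
  (A ×ˢ B).filter fun x => x.1 + x.2 ∈ C

theorem mem_sumPairs {A B C : Finset ℤ} {x : ℤ × ℤ} :
    x ∈ sumPairs A B C ↔ x.1 ∈ A ∧ x.2 ∈ B ∧ x.1 + x.2 ∈ C := by
  simp [sumPairs, and_assoc]

theorem card_sumPairs_le_mul (A B C : Finset ℤ) :
    (sumPairs A B C).card ≤ A.card * B.card :=
  (Finset.card_filter_le _ _).trans (Finset.card_product A B).le

/-- Any two of the three line labels m, n, m + n determine the point. -/
theorem card_sumPairs_le_mul_left (A B C : Finset ℤ) :
    (sumPairs A B C).card ≤ A.card * C.card := by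
  rw [← Finset.card_product]
  refine Finset.card_le_card_of_injOn (fun x => (x.1, x.1 + x.2)) ?_ ?_
  · intro x hx
    have := mem_sumPairs.1 hx
    simp [this.1, this.2.2]
  · rintro x - y - h
    simp only [Prod.mk.injEq] at h
    exact Prod.ext (by omega) (by omega)

theorem card_sumPairs_le_mul_right (A B C : Finset ℤ) :
    (sumPairs A B C).card ≤ B.card * C.card := by
  rw [← Finset.card_product]
  refine Finset.card_le_card_of_injOn (fun x => (x.2, x.1 + x.2)) ?_ ?_
  · intro x hx
    have := mem_sumPairs.1 hx
    simp [this.2.1, this.2.2]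
  · rintro x - y - h
    simp only [Prod.mk.injEq] at h
    exact Prod.ext (by omega) (by omega)

/-- The sum is injective on the pairs which have minimal first or maximal second coordinate, so
there are at most `♯C` of them. -/
theorem card_sumPairs_le_erase (A B C : Finset ℤ) (hA : A.Nonempty) (hB : B.Nonempty) :
    (sumPairs A B C).card ≤
      (sumPairs (A.erase (A.min' hA)) (B.erase (B.max' hB)) C).card + C.card := by
  set S := sumPairs A B C
  set T := sumPairs (A.erase (A.min' hA)) (B.erase (B.max' hB)) C
  have hle : (S \ T).card ≤ C.card := by
    refine Finset.card_le_card_of_injOn (fun x => x.1 + x.2) ?_ ?_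
    · intro x hx
      exact (mem_sumPairs.1 (Finset.mem_sdiff.1 hx).1).2.2
    · have key : ∀ x ∈ S \ T, x ∈ S ∧ (x.1 = A.min' hA ∨ x.2 = B.max' hB) := by
        intro x hx
        obtain ⟨hS, hT⟩ := Finset.mem_sdiff.1 hx
        refine ⟨hS, ?_⟩
        obtain ⟨h1, h2, h3⟩ := mem_sumPairs.1 hS
        by_contra! hc
        exact hT (mem_sumPairs.2
          ⟨Finset.mem_erase.2 ⟨hc.1, h1⟩, Finset.mem_erase.2 ⟨hc.2, h2⟩, h3⟩)
      -- These pairs form a chain for the product order: the row of the minimum of `A`, then the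
      -- column of the maximum of `B`. The sum is strictly increasing along it.
      intro x hx y hy h
      obtain ⟨hxS, hx⟩ := key x hx
      obtain ⟨hyS, hy⟩ := key y hy
      obtain ⟨h1, h2, -⟩ := mem_sumPairs.1 hxS
      obtain ⟨h3, h4, -⟩ := mem_sumPairs.1 hyS
      have := A.min'_le _ h1
      have := A.min'_le _ h3
      have := B.le_max' _ h2
      have := B.le_max' _ h4
      simp only at h
      exact Prod.ext (by omega) (by omega)
  have := Finset.card_le_card_sdiff_add_card (s := S) (t := T)
  omega

/-- Discrete Riesz rearrangement bound: the number of solutions is at most that for centred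
intervals, when the three cardinalities satisfy the triangle inequalities. -/
theorem four_mul_card_sumPairs_le (A B C : Finset ℤ) (hC : C.card ≤ A.card + B.card)
    (hA : A.card ≤ B.card + C.card) (hB : B.card ≤ A.card + C.card) :
    4 * ((sumPairs A B C).card : ℤ) ≤
      4 * A.card * B.card - (A.card + B.card - C.card) ^ 2 + 1 := by
  induction hn : A.card generalizing A B with
  | zero =>
    have h0 : (sumPairs A B C).card ≤ A.card * B.card := card_sumPairs_le_mul A B C
    have h1 : B.card = C.card := by omega
    rw [hn] at h0
    have h2 : (sumPairs A B C).card = 0 := by omega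
    rw [h2, h1]; simp
  | succ a ih =>
    -- Lowering a and b by one lowers the bound 4ab - (a + b - c)² + 1 by exactly 4c, matching
    -- `card_sumPairs_le_erase`. The descent stops when a + b ≤ c + 1: then |a + b - c| ≤ 1 and the
    -- trivial bound ab suffices.
    rcases Nat.lt_or_ge (C.card + 1) (A.card + B.card) with h | h
    · have hA0 : A.Nonempty := Finset.card_pos.1 (by omega)
      have hB0 : B.Nonempty := Finset.card_pos.1 (by omega)
      have h1 := card_sumPairs_le_erase A B C hA0 hB0
      have h2 := Finset.card_erase_of_mem (A.min'_mem hA0)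
      have h3 := Finset.card_erase_add_one (B.max'_mem hB0)
      have h4 := ih (A.erase (A.min' hA0)) (B.erase (B.max' hB0))
        (by omega) (by omega) (by omega) (by omega)
      have h5 : (B.card : ℤ) = (B.erase (B.max' hB0)).card + 1 := by exact_mod_cast h3.symm
      have h6 : ((sumPairs A B C).card : ℤ) ≤
        (sumPairs (A.erase (A.min' hA0)) (B.erase (B.max' hB0)) C).card + C.card := by
        exact_mod_cast h1
      rw [h5]
      push_cast
      linarith
    · have h0 : ((sumPairs A B C).card : ℤ) ≤ A.card * B.card := by
        exact_mod_cast card_sumPairs_le_mul A B C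
      rw [hn] at h0 h hC
      have : (((a + 1 : ℕ) : ℤ) + B.card - C.card) ^ 2 ≤ 1 := by
        rw [sq_le_one_iff_abs_le_one, abs_le]
        omega
      nlinarith

/-- Under the triangle inequalities, (a + b + c)² - 3(4ab - (a + b - c)²) is twice the sum of the
squared differences of a, b, c. If instead a + b ≤ c, then (a + b + c)² ≥ 4(a + b)² ≥ 16ab. -/
theorem twelve_mul_card_sumPairs_le (A B C : Finset ℤ) :
    12 * (sumPairs A B C).card ≤ (A.card + B.card + C.card) ^ 2 + 3 := by
  have aux : ∀ {n a b c : ℕ}, n ≤ a * b → a + b ≤ c → 12 * n ≤ (a + b + c) ^ 2 + 3 := by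
    intro n a b c h1 h2
    obtain ⟨d, rfl⟩ := Nat.exists_eq_add_of_le h2
    zify at *
    nlinarith [sq_nonneg ((a : ℤ) - b), mul_nonneg (Int.natCast_nonneg d)
      (add_nonneg (Int.natCast_nonneg a) (Int.natCast_nonneg b)), sq_nonneg (a : ℤ),
      sq_nonneg (b : ℤ), sq_nonneg (d : ℤ), mul_nonneg (Int.natCast_nonneg a) (Int.natCast_nonneg b)]
  rcases le_total (A.card + B.card) C.card with hC | hC
  · exact aux (card_sumPairs_le_mul A B C) hC
  rcases le_total (B.card + C.card) A.card with hA | hA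
  · have := aux (card_sumPairs_le_mul_right A B C) hA
    convert this using 3; ring
  rcases le_total (A.card + C.card) B.card with hB | hB
  · have := aux (card_sumPairs_le_mul_left A B C) hB
    convert this using 3; ring
  have h := four_mul_card_sumPairs_le A B C hC hA hB
  zify
  nlinarith [sq_nonneg ((A.card : ℤ) - B.card), sq_nonneg ((B.card : ℤ) - C.card),
    sq_nonneg ((C.card : ℤ) - A.card)]

/-! ### Boundary edges sorted by direction or by starting point -/

/-- The six unit vectors of the triangular lattice. -/
def directions : Finset (ℤ × ℤ) :=
  {(1, 0), (-1, 0), (0, 1), (0, -1), (1, -1), (-1, 1)}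

theorem adj_iff_sub_mem (x y : ℤ × ℤ) : graph.Adj x y ↔ y - x ∈ directions := by
  rw [graph_adj_iff]
  obtain ⟨a, b⟩ := x
  obtain ⟨c, d⟩ := y
  simp only [directions, Finset.mem_insert, Finset.mem_singleton, Prod.mk_sub_mk, Prod.mk.injEq]
  obtain ⟨u, rfl⟩ : ∃ u, c = a + u := ⟨c - a, by ring⟩
  obtain ⟨v, rfl⟩ : ∃ v, d = b + v := ⟨d - b, by ring⟩
  simp only [sub_add_cancel_left, add_sub_cancel_left]
  constructor
  · intro h
    have h1 : -1 ≤ u ∧ u ≤ 1 := by constructor <;> nlinarith [sq_nonneg (u + 2 * v)]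
    have h2 : -1 ≤ v ∧ v ≤ 1 := by constructor <;> nlinarith [sq_nonneg (2 * u + v)]
    obtain ⟨h3, h4⟩ := h1
    obtain ⟨h5, h6⟩ := h2
    interval_cases u <;> interval_cases v <;> simp_all
  · rintro (⟨rfl, rfl⟩ | ⟨rfl, rfl⟩ | ⟨rfl, rfl⟩ | ⟨rfl, rfl⟩ | ⟨rfl, rfl⟩ | ⟨rfl, rfl⟩) <;> norm_num

/-- The points of `Ω` from which the step `d` leaves `Ω`. -/
def exits (Ω : Finset (ℤ × ℤ)) (d : ℤ × ℤ) : Finset (ℤ × ℤ) :=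
  Ω.filter fun x => x + d ∉ Ω

theorem mem_exits {Ω : Finset (ℤ × ℤ)} {d x : ℤ × ℤ} : x ∈ exits Ω d ↔ x ∈ Ω ∧ x + d ∉ Ω := by
  simp [exits]

/-- The oriented boundary edges as pairs of a starting point and a direction. -/
theorem perimeter_eq_card_filter (Ω : Finset (ℤ × ℤ)) :
    perimeter Ω = ((Ω ×ˢ directions).filter fun p => p.1 + p.2 ∉ Ω).card := by
  rw [perimeter, ← Set.ncard_coe_finset]
  refine Set.ncard_congr (fun p _ => (p.1, p.2 - p.1)) ?_ ?_ ?_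
  · rintro ⟨x, y⟩ ⟨h1, h2, h3⟩
    simp only [adj_iff_sub_mem] at h1
    simp_all
  · rintro ⟨x, y⟩ ⟨x', y'⟩ - - h
    simp only [Prod.mk.injEq] at h
    obtain ⟨rfl, h⟩ := h
    simpa using h
  · rintro ⟨x, d⟩ h
    simp only [Finset.coe_filter, Finset.mem_product, Set.mem_ofPred_eq] at h
    exact ⟨(x, x + d), ⟨by rw [adj_iff_sub_mem]; simpa using h.1.2, h.1.1, h.2⟩, by simp⟩

theorem perimeter_eq_sum_exits (Ω : Finset (ℤ × ℤ)) :
    perimeter Ω = ∑ d ∈ directions, (exits Ω d).card := by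
  rw [perimeter_eq_card_filter]
  simp only [exits, Finset.card_filter, Finset.sum_product_right]

theorem perimeter_eq_sum_missing (Ω : Finset (ℤ × ℤ)) :
    perimeter Ω = ∑ x ∈ Ω, (directions.filter fun d => x + d ∉ Ω).card := by
  rw [perimeter_eq_card_filter]
  simp only [Finset.card_filter, Finset.sum_product]

theorem sum_directions {M : Type*} [AddCommMonoid M] (g : ℤ × ℤ → M) :
    ∑ d ∈ directions, g d =
      g (1, 0) + (g (-1, 0) + (g (0, 1) + (g (0, -1) + (g (1, -1) + g (-1, 1))))) := by
  simp [directions]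

/-- Every line in direction `d` which meets `Ω` leaves it: `f` labels the lines. -/
theorem card_image_le_card_exits (Ω : Finset (ℤ × ℤ)) {d : ℤ × ℤ} (hd : d ≠ 0)
    (f : ℤ × ℤ → ℤ) (hf : ∀ x, f (x + d) = f x) :
    (Ω.image f).card ≤ (exits Ω d).card := by
  refine (Finset.card_le_card ?_).trans (Finset.card_image_le (f := f))
  intro t ht
  obtain ⟨x, hx, rfl⟩ := Finset.mem_image.1 ht
  by_contra hc
  -- If the line through x has no exit, the ray x, x + d, x + 2d, ... never leaves the finite set Ω.
  have stay : ∀ n : ℕ, x + n • d ∈ Ω ∧ f (x + n • d) = f x := by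
    intro n
    induction n with
    | zero => simpa using hx
    | succ n ih =>
      have e : x + (n + 1) • d = x + n • d + d := by rw [succ_nsmul, add_assoc]
      rw [e, hf]
      refine ⟨?_, ih.2⟩
      by_contra h
      exact hc (Finset.mem_image.2 ⟨_, mem_exits.2 ⟨ih.1, h⟩, ih.2⟩)
  refine Set.not_injOn_infinite_finite_image (f := fun n : ℕ => x + n • d) Set.infinite_univ ?_ ?_
  · refine Ω.finite_toSet.subset ?_
    rintro _ ⟨n, -, rfl⟩
    exact (stay n).1
  · intro a _ b _ h
    have h' : a • d = b • d := add_left_cancel h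
    by_contra hab
    apply hd
    have h1 : a * d.1 = b * d.1 := by
      rw [← nsmul_eq_mul, ← nsmul_eq_mul]; exact congrArg Prod.fst h'
    have h2 : a * d.2 = b * d.2 := by
      rw [← nsmul_eq_mul, ← nsmul_eq_mul]; exact congrArg Prod.snd h'
    have hab' : (a : ℤ) ≠ b := by exact_mod_cast hab
    refine Prod.ext ?_ ?_
    · by_contra h0; exact hab' (mul_right_cancel₀ h0 h1)
    · by_contra h0; exact hab' (mul_right_cancel₀ h0 h2)

/-! ### The isoperimetric inequality and positivity of the denominator -/

/-- The edge-isoperimetric inequality of the triangular lattice. -/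
theorem card_le_perimeter_sq (Ω : Finset (ℤ × ℤ)) :
    48 * Ω.card ≤ perimeter Ω ^ 2 + 12 := by
  set A := Ω.image Prod.fst
  set B := Ω.image Prod.snd
  set C := Ω.image fun x => x.1 + x.2
  have h1 : Ω.card ≤ (sumPairs A B C).card := by
    refine Finset.card_le_card fun x hx => mem_sumPairs.2 ⟨?_, ?_, ?_⟩
    · exact Finset.mem_image_of_mem _ hx
    · exact Finset.mem_image_of_mem _ hx
    · exact Finset.mem_image_of_mem (fun x : ℤ × ℤ => x.1 + x.2) hx
  have h2 := twelve_mul_card_sumPairs_le A B C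
  -- Opposite directions share their lines, so each family of lines is counted twice.
  have h3 : 2 * (A.card + B.card + C.card) ≤ perimeter Ω := by
    rw [perimeter_eq_sum_exits, sum_directions]
    have e1 : B.card ≤ (exits Ω (1, 0)).card :=
      card_image_le_card_exits Ω (by decide) _ (by simp)
    have e2 : B.card ≤ (exits Ω (-1, 0)).card :=
      card_image_le_card_exits Ω (by decide) _ (by simp)
    have e3 : A.card ≤ (exits Ω (0, 1)).card :=
      card_image_le_card_exits Ω (by decide) _ (by simp)
    have e4 : A.card ≤ (exits Ω (0, -1)).card :=
      card_image_le_card_exits Ω (by decide) _ (by simp)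
    have e5 : C.card ≤ (exits Ω (1, -1)).card :=
      card_image_le_card_exits Ω (by decide) _ (by intro x; simp; ring)
    have e6 : C.card ≤ (exits Ω (-1, 1)).card :=
      card_image_le_card_exits Ω (by decide) _ (by intro x; simp; ring)
    omega
  have h4 := Nat.pow_le_pow_left h3 2
  rw [mul_pow] at h4
  omega

theorem div_ge_twelve (Ω : Finset (ℤ × ℤ))
    (h : (0 : ℝ) < 4 * (Ω.card : ℝ) - (perimeter Ω : ℝ) + 2) :
    ((perimeter Ω : ℝ) - 6) ^ 2 / (4 * (Ω.card : ℝ) - (perimeter Ω : ℝ) + 2) ≥ 12 := by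
  have h1 : 48 * (Ω.card : ℝ) ≤ (perimeter Ω : ℝ) ^ 2 + 12 := by
    exact_mod_cast card_le_perimeter_sq Ω
  rw [ge_iff_le, le_div_iff₀ h]
  linarith

/-- A point of a union of triangles has at least two neighbours. -/
theorem IsUnionOfTriangles.perimeter_le {Ω : Finset (ℤ × ℤ)} (h : IsUnionOfTriangles Ω) :
    perimeter Ω ≤ 4 * Ω.card := by
  rw [perimeter_eq_sum_missing, mul_comm, ← smul_eq_mul]
  refine Finset.sum_le_card_nsmul _ _ _ fun x hx => ?_
  obtain ⟨y, hy, z, hz, hxy, hyz, hzx⟩ := h x hx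
  have h2 : 2 ≤ (directions.filter fun d => ¬ x + d ∉ Ω).card := by
    rw [← Finset.card_pair (a := y - x) (b := z - x) (by simpa using hyz.ne)]
    refine Finset.card_le_card fun d hd => ?_
    rcases Finset.mem_insert.1 hd with rfl | hd
    · simpa [hy] using (adj_iff_sub_mem x y).1 hxy
    · rw [Finset.mem_singleton.1 hd]
      simpa [hz] using (adj_iff_sub_mem x z).1 hzx.symm
  have h3 := Finset.card_filter_add_card_filter_not (s := directions) fun d => x + d ∉ Ω
  have h4 : directions.card = 6 := rfl
  omega

/-! ### Cycles from closed vertex sequences -/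

open SimpleGraph in
/-- A closed sequence of distinct vertices with consecutive terms adjacent is a cycle. -/
theorem exists_isCycle_support_eq {V : Type*} {G : SimpleGraph V} (n : ℕ) (f : ℕ → V)
    (hinj : Set.InjOn f (Set.Iio (n + 3))) (hclosed : f (n + 3) = f 0)
    (hadj : ∀ i < n + 3, G.Adj (f i) (f (i + 1))) :
    ∃ (v : V) (w : G.Walk v v), w.IsCycle ∧ {x | x ∈ w.support} = f '' Set.Iio (n + 3) := by
  have hstep : ∀ u v : Fin (n + 3), (u - v).val = 1 → G.Adj (f v) (f u) := by
    intro u v h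
    have hu := u.isLt
    have hv := v.isLt
    rw [Fin.val_sub] at h
    rcases Nat.lt_or_ge u.val v.val with huv | huv
    · rw [Nat.mod_eq_of_lt (by omega)] at h
      have h1 : u.val = 0 := by omega
      have h2 : v.val + 1 = n + 3 := by omega
      have := hadj v hv
      rwa [h2, hclosed, ← h1] at this
    · rw [show n + 3 - v.val + u.val = (u.val - v.val) + (n + 3) by omega, Nat.add_mod_right,
        Nat.mod_eq_of_lt (by omega)] at h
      have := hadj v hv
      rwa [show v.val + 1 = u.val by omega] at this
  let φ : cycleGraph (n + 3) →g G :=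
    { toFun := fun i => f i
      map_rel' := by
        intro u v h
        rcases cycleGraph_adj'.1 h with h | h
        · exact (hstep u v h).symm
        · exact hstep v u h }
  have hφ : Function.Injective φ := fun u v h => Fin.ext (hinj u.isLt v.isLt h)
  refine ⟨φ 0, (cycleGraph.cycle n).map φ,
    (Walk.isCycle_map_iff_of_injective hφ).2 cycleGraph.isCycle_cycle, ?_⟩
  ext x
  simp only [Walk.support_map, Set.mem_ofPred_eq, List.mem_map, Set.mem_image, Set.mem_Iio]
  constructor
  · rintro ⟨i, -, rfl⟩
    exact ⟨i, i.isLt, rfl⟩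
  · rintro ⟨i, hi, rfl⟩
    refine ⟨⟨i, hi⟩, ?_, rfl⟩
    rw [Walk.mem_support_iff_exists_getVert]
    -- `cycleGraph.cycle` visits the vertices in decreasing order.
    refine ⟨n + 3 - i, ?_, by simp⟩
    rw [cycleGraph.getVert_cycle (by omega)]
    ext
    simp only
    rw [show n + 3 - (n + 3 - i) = i by omega, Nat.mod_eq_of_lt hi]

/-! ### Cardinality, perimeter and triangles of the hexagon -/

theorem mem_hexagon {k : ℕ} {x : ℤ × ℤ} :
    x ∈ hexagon k ↔ -(k : ℤ) ≤ x.1 ∧ x.1 ≤ k ∧ -(k : ℤ) ≤ x.2 ∧ x.2 ≤ k ∧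
      -(k : ℤ) ≤ x.1 + x.2 ∧ x.1 + x.2 ≤ k := by
  simp [hexagon, and_assoc]

theorem card_hexagon (k : ℕ) : (hexagon k).card = 3 * k ^ 2 + 3 * k + 1 := by
  have h1 : ∀ m ∈ Finset.Icc (-(k : ℤ)) k,
      ((hexagon k).filter fun x => x.1 = m).card = 2 * k + 1 - m.natAbs := by
    intro m hm
    rw [Finset.mem_Icc] at hm
    have : ((hexagon k).filter fun x => x.1 = m) =
        (Finset.Icc (max (-(k : ℤ)) (-k - m)) (min (k : ℤ) (k - m))).image fun n => (m, n) := by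
      ext ⟨a, b⟩
      simp only [Finset.mem_filter, mem_hexagon, Finset.mem_image, Finset.mem_Icc, Prod.mk.injEq]
      constructor
      · rintro ⟨h, h'⟩
        exact ⟨b, by omega, h'.symm, rfl⟩
      · rintro ⟨n, h, h', h''⟩
        omega
    rw [this, Finset.card_image_of_injective _ fun a b h => (Prod.mk.inj h).2, Int.card_Icc]
    omega
  have h2 : (hexagon k).card = ∑ m ∈ Finset.Icc (-(k : ℤ)) k, (2 * k + 1 - m.natAbs) := by
    rw [← Finset.sum_congr rfl h1]
    refine Finset.card_eq_sum_card_fiberwise fun x hx => ?_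
    have := mem_hexagon.1 hx
    simp only [Finset.coe_Icc, Set.mem_Icc]
    omega
  -- The constant c is kept apart from the range j so that induction on j can fix it; j ≤ c keeps
  -- the subtraction from truncating.
  have h3 : ∀ j c : ℕ, j ≤ c →
      ∑ m ∈ Finset.Icc (-(j : ℤ)) j, (c - m.natAbs) + j * (j + 1) = (2 * j + 1) * c := by
    intro j c
    induction j with
    | zero => simp
    | succ j ih =>
      intro hj
      have e : Finset.Icc (-((j + 1 : ℕ) : ℤ)) ((j + 1 : ℕ) : ℤ) =
          insert (-((j + 1 : ℕ) : ℤ)) (insert ((j + 1 : ℕ) : ℤ) (Finset.Icc (-(j : ℤ)) j)) := by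
        ext m
        simp only [Finset.mem_Icc, Finset.mem_insert]
        omega
      rw [e, Finset.sum_insert (by simp; omega), Finset.sum_insert (by simp)]
      have := ih (by omega)
      rw [Int.natAbs_neg, Int.natAbs_natCast]
      obtain ⟨d, rfl⟩ := Nat.exists_eq_add_of_le hj
      rw [Nat.add_sub_cancel_left]
      linarith
  have := h3 k (2 * k + 1) (by omega)
  rw [h2]
  linarith

/-- Here f labels the lines in direction d; by convexity each is left at most once, and 2k + 1
labels are available. -/
theorem card_exits_hexagon_le (k : ℕ) {d : ℤ × ℤ} (f : ℤ × ℤ → ℤ)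
    (hf : ∀ x ∈ hexagon k, -(k : ℤ) ≤ f x ∧ f x ≤ k)
    (hinj : Set.InjOn f (exits (hexagon k) d)) :
    (exits (hexagon k) d).card ≤ 2 * k + 1 := by
  have h : (exits (hexagon k) d).card ≤ (Finset.Icc (-(k : ℤ)) k).card := by
    refine Finset.card_le_card_of_injOn f (fun x hx => ?_) hinj
    simpa using hf x (mem_exits.1 hx).1
  rw [Int.card_Icc] at h
  omega

theorem perimeter_hexagon (k : ℕ) : perimeter (hexagon k) = 12 * k + 6 := by
  apply le_antisymm
  · have inj : ∀ (d : ℤ × ℤ) (f : ℤ × ℤ → ℤ),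
        (∀ x y : ℤ × ℤ,
          (-(k : ℤ) ≤ x.1 ∧ x.1 ≤ k ∧ -(k : ℤ) ≤ x.2 ∧ x.2 ≤ k ∧
            -(k : ℤ) ≤ x.1 + x.2 ∧ x.1 + x.2 ≤ k) ∧
          ¬ (-(k : ℤ) ≤ x.1 + d.1 ∧ x.1 + d.1 ≤ k ∧ -(k : ℤ) ≤ x.2 + d.2 ∧ x.2 + d.2 ≤ k ∧
            -(k : ℤ) ≤ x.1 + d.1 + (x.2 + d.2) ∧ x.1 + d.1 + (x.2 + d.2) ≤ k) →
          (-(k : ℤ) ≤ y.1 ∧ y.1 ≤ k ∧ -(k : ℤ) ≤ y.2 ∧ y.2 ≤ k ∧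
            -(k : ℤ) ≤ y.1 + y.2 ∧ y.1 + y.2 ≤ k) ∧
          ¬ (-(k : ℤ) ≤ y.1 + d.1 ∧ y.1 + d.1 ≤ k ∧ -(k : ℤ) ≤ y.2 + d.2 ∧ y.2 + d.2 ≤ k ∧
            -(k : ℤ) ≤ y.1 + d.1 + (y.2 + d.2) ∧ y.1 + d.1 + (y.2 + d.2) ≤ k) →
          f x = f y → x.1 = y.1 ∧ x.2 = y.2) →
        Set.InjOn f (exits (hexagon k) d) := by
      intro d f h x hx y hy hxy
      rw [Finset.mem_coe, mem_exits, mem_hexagon, mem_hexagon] at hx hy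
      have := h x y hx hy hxy
      exact Prod.ext this.1 this.2
    have step : ∀ d ∈ directions, (exits (hexagon k) d).card ≤ 2 * k + 1 := by
      intro d hd
      simp only [directions, Finset.mem_insert, Finset.mem_singleton] at hd
      rcases hd with rfl | rfl | rfl | rfl | rfl | rfl
      · exact card_exits_hexagon_le k Prod.snd (fun x hx => by rw [mem_hexagon] at hx; omega)
          (inj _ _ fun x y hx hy h => by simp only at h hx hy ⊢; omega)
      · exact card_exits_hexagon_le k Prod.snd (fun x hx => by rw [mem_hexagon] at hx; omega)
          (inj _ _ fun x y hx hy h => by simp only at h hx hy ⊢; omega)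
      · exact card_exits_hexagon_le k Prod.fst (fun x hx => by rw [mem_hexagon] at hx; omega)
          (inj _ _ fun x y hx hy h => by simp only at h hx hy ⊢; omega)
      · exact card_exits_hexagon_le k Prod.fst (fun x hx => by rw [mem_hexagon] at hx; omega)
          (inj _ _ fun x y hx hy h => by simp only at h hx hy ⊢; omega)
      · exact card_exits_hexagon_le k (fun x => x.1 + x.2)
          (fun x hx => by rw [mem_hexagon] at hx; omega)
          (inj _ _ fun x y hx hy h => by simp only at h hx hy ⊢; omega)
      · exact card_exits_hexagon_le k (fun x => x.1 + x.2)
          (fun x hx => by rw [mem_hexagon] at hx; omega)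
          (inj _ _ fun x y hx hy h => by simp only at h hx hy ⊢; omega)
    rw [perimeter_eq_sum_exits]
    refine (Finset.sum_le_card_nsmul _ _ _ step).trans ?_
    rw [show directions.card = 6 from rfl, smul_eq_mul]
    omega
  · have h := card_le_perimeter_sq (hexagon k)
    rw [card_hexagon] at h
    by_contra! hc
    nlinarith

theorem isUnionOfTriangles_hexagon {k : ℕ} (hk : 1 ≤ k) : IsUnionOfTriangles (hexagon k) := by
  have key : ∀ x ∈ hexagon k, ∃ d ∈ directions, ∃ e ∈ directions, e - d ∈ directions ∧
      x + d ∈ hexagon k ∧ x + e ∈ hexagon k := by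
    intro x hx
    simp only [mem_hexagon, Prod.fst_add, Prod.snd_add] at hx ⊢
    -- In each of the six sectors two neighbouring directions point inwards.
    rcases le_total 0 x.1 with h1 | h1 <;> rcases le_total 0 x.2 with h2 | h2
    · exact ⟨(-1, 0), by decide, (0, -1), by decide, by decide, by omega, by omega⟩
    · rcases le_total 0 (x.1 + x.2) with h3 | h3
      · exact ⟨(-1, 0), by decide, (-1, 1), by decide, by decide, by omega, by omega⟩
      · exact ⟨(0, 1), by decide, (-1, 1), by decide, by decide, by omega, by omega⟩
    · rcases le_total 0 (x.1 + x.2) with h3 | h3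
      · exact ⟨(0, -1), by decide, (1, -1), by decide, by decide, by omega, by omega⟩
      · exact ⟨(1, 0), by decide, (1, -1), by decide, by decide, by omega, by omega⟩
    · exact ⟨(1, 0), by decide, (0, 1), by decide, by decide, by omega, by omega⟩
  intro x hx
  obtain ⟨d, hd, e, he, hde, h1, h2⟩ := key x hx
  refine ⟨x + d, h1, x + e, h2, ?_, ?_, ?_⟩
  · rwa [adj_iff_sub_mem, add_sub_cancel_left]
  · rwa [adj_iff_sub_mem, add_sub_add_left_eq_sub]
  · rwa [graph.adj_comm, adj_iff_sub_mem, add_sub_cancel_left]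

/-! ### The boundary cycle of the hexagon -/

theorem mem_boundaryVertices_iff {Ω : Finset (ℤ × ℤ)} {x : ℤ × ℤ} :
    x ∈ boundaryVertices Ω ↔ x ∈ Ω ∧ ∃ d ∈ directions, x + d ∉ Ω := by
  have h1 : {y | y ∈ Ω ∧ graph.Adj x y}.ncard = (directions.filter fun d => x + d ∈ Ω).card := by
    rw [← Set.ncard_coe_finset]
    refine Set.ncard_congr (fun y _ => y - x) ?_ ?_ ?_
    · rintro y ⟨hy, h⟩
      simpa [hy] using (adj_iff_sub_mem x y).1 h
    · intro y z _ _ h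
      exact sub_left_injective h
    · intro d hd
      simp only [Finset.coe_filter, Set.mem_ofPred_eq] at hd
      exact ⟨x + d, ⟨hd.2, by rw [adj_iff_sub_mem]; simpa using hd.1⟩, by simp⟩
  change (x ∈ Ω ∧ _ < 6) ↔ _
  rw [h1, show 6 = directions.card from rfl,
    (Finset.card_filter_le _ _).lt_iff_ne, Ne, Finset.card_filter_eq_iff]
  push Not
  rfl

theorem boundaryVertices_hexagon (k : ℕ) :
    boundaryVertices (hexagon k) = {x | x ∈ hexagon k ∧
      (x.1 = k ∨ x.1 = -k ∨ x.2 = k ∨ x.2 = -k ∨ x.1 + x.2 = k ∨ x.1 + x.2 = -k)} := by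
  ext x
  rw [mem_boundaryVertices_iff]
  refine and_congr_right fun hx => ?_
  rw [mem_hexagon] at hx
  simp only [directions, Finset.exists_mem_insert, Finset.mem_singleton, exists_eq_left,
    mem_hexagon, Prod.fst_add, Prod.snd_add]
  omega

/-- The boundary of the hexagon, traversed counterclockwise from `(k, 0)`. -/
def hexagonBoundary (k i : ℕ) : ℤ × ℤ :=
  (max (-(k : ℤ)) (min k (max (k - i) (i - 4 * k))),
    max (-(k : ℤ)) (min k (min i (max (3 * k - i) (i - 6 * k)))))

theorem image_hexagonBoundary {k : ℕ} (hk : 1 ≤ k) :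
    hexagonBoundary k '' Set.Iio (6 * k) = boundaryVertices (hexagon k) := by
  rw [boundaryVertices_hexagon]
  ext ⟨a, b⟩
  simp only [Set.mem_image, Set.mem_Iio, hexagonBoundary, Prod.mk.injEq, Set.mem_ofPred_eq,
    mem_hexagon]
  constructor
  · rintro ⟨i, hi, rfl, rfl⟩
    omega
  · intro h
    -- The six sides, each with its starting corner and without its final one; the corners occur at
    -- multiples of k.
    have : (a + b = k ∧ 0 ≤ b ∧ 0 < a) ∨ (b = k ∧ a ≤ 0 ∧ -k < a) ∨ (a = -k ∧ 0 < b) ∨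
        (a + b = -k ∧ b ≤ 0 ∧ a < 0) ∨ (b = -k ∧ 0 ≤ a ∧ a < k) ∨ (a = k ∧ b < 0) := by omega
    rcases this with h | h | h | h | h | h
    · exact ⟨b.toNat, by omega, by omega, by omega⟩
    · exact ⟨(k - a).toNat, by omega, by omega, by omega⟩
    · exact ⟨(3 * k - b).toNat, by omega, by omega, by omega⟩
    · exact ⟨(3 * k - b).toNat, by omega, by omega, by omega⟩
    · exact ⟨(4 * k + a).toNat, by omega, by omega, by omega⟩
    · exact ⟨(6 * k + b).toNat, by omega, by omega, by omega⟩

theorem injOn_hexagonBoundary (k : ℕ) : Set.InjOn (hexagonBoundary k) (Set.Iio (6 * k)) := by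
  intro i hi j hj h
  simp only [Set.mem_Iio, hexagonBoundary, Prod.mk.injEq] at hi hj h
  omega

theorem adj_hexagonBoundary {k i : ℕ} (hi : i < 6 * k) :
    graph.Adj (hexagonBoundary k i) (hexagonBoundary k (i + 1)) := by
  simp only [adj_iff_sub_mem, directions, hexagonBoundary, Finset.mem_insert,
    Finset.mem_singleton, Prod.mk_sub_mk, Prod.mk.injEq]
  push_cast
  have : i < k ∨ (k ≤ i ∧ i < 2 * k) ∨ (2 * k ≤ i ∧ i < 3 * k) ∨ (3 * k ≤ i ∧ i < 4 * k) ∨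
      (4 * k ≤ i ∧ i < 5 * k) ∨ 5 * k ≤ i := by omega
  rcases this with h | h | h | h | h | h
  · exact .inr (.inr (.inr (.inr (.inr ⟨by omega, by omega⟩))))
  · exact .inr (.inl ⟨by omega, by omega⟩)
  · exact .inr (.inr (.inr (.inl ⟨by omega, by omega⟩)))
  · exact .inr (.inr (.inr (.inr (.inl ⟨by omega, by omega⟩))))
  · exact .inl ⟨by omega, by omega⟩
  · exact .inr (.inr (.inl ⟨by omega, by omega⟩))

theorem boundaryIsSimpleCycle_hexagon {k : ℕ} (hk : 1 ≤ k) :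
    BoundaryIsSimpleCycle (hexagon k) := by
  have hn : 6 * k - 3 + 3 = 6 * k := by omega
  have h := exists_isCycle_support_eq (G := graph) (6 * k - 3) (hexagonBoundary k)
    (by rw [hn]; exact injOn_hexagonBoundary k)
    (by rw [hn]; simp only [hexagonBoundary, Prod.mk.injEq]; omega)
    (by rw [hn]; exact fun i => adj_hexagonBoundary)
  rwa [hn, image_hexagonBoundary hk] at h

end TriangularGraph

theorem mainTheorem5 :
    -- the inequality for all finite sets for which the denominator is positive
    (∀ Ω : Finset (ℤ × ℤ),
      (0 : ℝ) < 4 * (Ω.card : ℝ) - (TriangularGraph.perimeter Ω : ℝ) + 2 →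
      ((TriangularGraph.perimeter Ω : ℝ) - 6) ^ 2 /
        (4 * (Ω.card : ℝ) - (TriangularGraph.perimeter Ω : ℝ) + 2) ≥ 12) ∧
    -- unions of triangles bounded by a single simple cycle: the denominator is positive
    (∀ Ω : Finset (ℤ × ℤ),
      TriangularGraph.IsUnionOfTriangles Ω → TriangularGraph.BoundaryIsSimpleCycle Ω →
      (0 : ℝ) < 4 * (Ω.card : ℝ) - (TriangularGraph.perimeter Ω : ℝ) + 2 ∧
      ((TriangularGraph.perimeter Ω : ℝ) - 6) ^ 2 /
        (4 * (Ω.card : ℝ) - (TriangularGraph.perimeter Ω : ℝ) + 2) ≥ 12) ∧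
    -- the cardinalities for the regular hexagons
    (∀ k : ℕ,
      (TriangularGraph.hexagon k).card = 3 * k ^ 2 + 3 * k + 1 ∧
      TriangularGraph.perimeter (TriangularGraph.hexagon k) = 12 * k + 6) ∧
    -- the regular hexagons are admissible and attain equality
    (∀ k : ℕ, 1 ≤ k →
      TriangularGraph.IsUnionOfTriangles (TriangularGraph.hexagon k) ∧
      TriangularGraph.BoundaryIsSimpleCycle (TriangularGraph.hexagon k) ∧
      ((TriangularGraph.perimeter (TriangularGraph.hexagon k) : ℝ) - 6) ^ 2 /
        (4 * ((TriangularGraph.hexagon k).card : ℝ) -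
          (TriangularGraph.perimeter (TriangularGraph.hexagon k) : ℝ) + 2) = 12) := by
  refine ⟨TriangularGraph.div_ge_twelve, fun Ω hΩ _ => ?_,
    fun k => ⟨TriangularGraph.card_hexagon k, TriangularGraph.perimeter_hexagon k⟩, fun k hk =>
    ⟨TriangularGraph.isUnionOfTriangles_hexagon hk,
      TriangularGraph.boundaryIsSimpleCycle_hexagon hk, ?_⟩⟩
  · have h : (TriangularGraph.perimeter Ω : ℝ) ≤ 4 * (Ω.card : ℝ) := by
      exact_mod_cast hΩ.perimeter_le
    have h0 : (0 : ℝ) < 4 * (Ω.card : ℝ) - (TriangularGraph.perimeter Ω : ℝ) + 2 := by linarith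
    exact ⟨h0, TriangularGraph.div_ge_twelve Ω h0⟩
  · rw [TriangularGraph.card_hexagon, TriangularGraph.perimeter_hexagon]
    have hk' : (0 : ℝ) < k := by exact_mod_cast hk
    push_cast
    rw [div_eq_iff (by nlinarith)]
    ring
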